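/- **Notation.** Let $p_0\ge 1$ be a rational number. Put $p_1=1$, $\nu_i=[p_i/p_{i+1}]$, $p_{i+2}=p_i-\nu_ip_{i+1}$ for $i\ge 0$, so that $p_0=[\nu_0,\nu_1,\dots,\nu_\alpha]$ is the continued fraction of $p_0$, where $\alpha\ge0$ is the least index with $p_{\alpha+2}=0$. Put $y_{-1}=0$, $y_0=1$, $y_{i+1}=y_{i-1}+\nu_iy_i$ and $m_0=0$, $m_{i+1}=m_i+\nu_i$ for $0\le i\le\alpha$. For $j\ge 0$ let $r(j)=i$ if $m_i\le j<m_{i+1}$ with $0\le i\le\alpha$, let $r(j)=\alpha+1$ if $j\ge m_{\alpha+1}$, and let $n_j=y_{i-1}+(j-m_i)y_i$ with $i=r(j)$. Let $\Theta^{-1}=(c_{ij})_{1\le i,j\le m_{\alpha+1}}$ be the symmetric tridiagonal matrix with $$c_{j-1,j}=(-1)^{r(j)-1},\qquad c_{jj}=\begin{cases}(-1)^{\alpha+1}, & j=m_{\alpha+1},\\ (-1)^{i}, & j=m_{i+1}-1,\ i=r(j)\le\alpha,\\ 2(-1)^{i}, & m_i\le j<m_{i+1}-1,\ i=r(j)\le\alpha,\end{cases}$$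 and let $B=2\Theta$. For an integer $l\ge0$ put $$V_l^{(p_0)}(q)=\sum_{\lambda}\frac{q^{\frac12\widetilde\lambda B\widetilde\lambda^t}}{\prod_{j}(q^{\epsilon(j)};q^{\epsilon(j)})_{\lambda_j}},\qquad \epsilon(j)=(-1)^{r(j)},\quad \widetilde\lambda_j=(-1)^{r(j)}\lambda_j,$$ where the (finite) sum is over all sequences $\lambda=(\lambda_1,\dots,\lambda_{m_{\alpha+1}})$ of non-negative integers with $\sum_kn_k\lambda_k=l$. Here $(x;q)_N=\prod_{k=0}^{N-1}(1-xq^k)$ and $(x;q)_\infty=\prod_{k\ge0}(1-xq^k)$. **Statement.** Let $p_0\ge1$ be an integer (so that $\alpha=0$), and let $q$ be a complex number with $0<|q|<1$. Fix any logarithm $w$ of $q$, and read every rational power of $q$ as $q^a=e^{aw}$. Then all the series and products below converge absolutely, $(q;q)_\infty\ne0$, and $$\sum_{l\ge0}q^{l^2/p_0}V_l^{(p_0)}(q)=1+\sum_{k>0}(-1)^kq^{k^2p_0+\frac{k(k-1)}2}(1+q^k),$$ $$\sum_{l\ge0}q^{l^2/p_0}V_l^{(p_0)}(q)=\prod_{n\ge1}\bigl(1-q^{(2p_0+1)n}\bigr)\bigl(1-q^{(2p_0+1)n-p_0-1}\bigr)\bigl(1-q^{(2p_0+1)n-p_0}\bigr),$$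 $$\frac1{(q;q)_\infty}\sum_{l\ge0}q^{l^2/p_0}V_l^{(p_0)}(q)=\prod_{\substack{n\ge1\\ n\not\equiv0,\,p_0,\,p_0+1\ (\mathrm{mod}\ 2p_0+1)}}\frac1{1-q^n}.$$ -/

import Mathlib

namespace XXZ

/-- The sequence `p₀, p₁ = 1, p_{i+2} = p_i - ν_i p_{i+1}`, with `ν_i = [p_i / p_{i+1}]`. -/
def p (p0 : ℚ) : ℕ → ℚ
  | 0 => p0
  | 1 => 1
  | i + 2 => p p0 i - (⌊p p0 i / p p0 (i + 1)⌋₊ : ℚ) * p p0 (i + 1)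

/-- The partial quotients `ν_i` of the continued fraction `p₀ = [ν₀, ν₁, …, ν_α]`
(meaningful for `i ≤ α`). -/
def nu (p0 : ℚ) (i : ℕ) : ℕ := ⌊p p0 i / p p0 (i + 1)⌋₊

/-- The index `α` of the last partial quotient of the rational number `p₀`. -/
noncomputable def alpha (p0 : ℚ) : ℕ := sInf {a : ℕ | p p0 (a + 2) = 0}

/-- `m₀ = 0`, `m_{i+1} = m_i + ν_i`. -/
def m (p0 : ℚ) : ℕ → ℕ
  | 0 => 0
  | i + 1 => m p0 i + nu p0 i

/-- The sequence `y`, with indices shifted by one: `yShift p0 i` is `y_{i-1}`, where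
`y_{-1} = 0`, `y₀ = 1`, `y_{i+1} = y_{i-1} + ν_i y_i`. -/
def yShift (p0 : ℚ) : ℕ → ℕ
  | 0 => 0
  | 1 => 1
  | i + 2 => yShift p0 i + nu p0 i * yShift p0 (i + 1)

/-- `r(j) = i` if `m_i ≤ j < m_{i+1}`, and `r(j) = α + 1` if `m_{α+1} ≤ j`; as
`0 = m₀ < m₁ < ⋯ < m_{α+1}`, this is the number of `i ∈ {1, …, α + 1}` with `m_i ≤ j`. -/
noncomputable def r (p0 : ℚ) (j : ℕ) : ℕ :=
  ((Finset.Icc 1 (alpha p0 + 1)).filter fun i => m p0 i ≤ j).card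

/-- The piecewise linear function `n_j = y_{i-1} + (j - m_i) y_i` for `i = r(j)`. -/
noncomputable def n (p0 : ℚ) (j : ℕ) : ℕ :=
  yShift p0 (r p0 j) + (j - m p0 (r p0 j)) * yShift p0 (r p0 j + 1)

/-- The number `m_{α+1}`, the size of the matrix `Θ`. -/
noncomputable def size (p0 : ℚ) : ℕ := m p0 (alpha p0 + 1)

/-- The entry `c_{ij}`, `1 ≤ i, j ≤ m_{α+1}`, of the matrix `Θ⁻¹`. -/
noncomputable def c (p0 : ℚ) (i j : ℕ) : ℚ :=
  if i = j then
    if j = size p0 then (-1) ^ (alpha p0 + 1)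
    else if j + 1 = m p0 (r p0 j + 1) then (-1) ^ r p0 j
    else 2 * (-1) ^ r p0 j
  else if i + 1 = j then (-1) ^ (r p0 j + 1)
  else if j + 1 = i then (-1) ^ (r p0 i + 1)
  else 0

/-- The symmetric matrix `Θ⁻¹ = (c_{ij})`; the position `k : Fin m_{α+1}` stands for the index
`k + 1 ∈ {1, …, m_{α+1}}`. -/
noncomputable def thetaInv (p0 : ℚ) : Matrix (Fin (size p0)) (Fin (size p0)) ℚ :=
  Matrix.of fun i j => c p0 (i.val + 1) (j.val + 1)

/-- The matrix `B = 2 Θ`. -/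
noncomputable def B (p0 : ℚ) : Matrix (Fin (size p0)) (Fin (size p0)) ℚ :=
  (2 : ℚ) • (thetaInv p0)⁻¹

/-- The sequence `λ̃_j = (-1)^{r(j)} λ_j`. -/
noncomputable def tilde (p0 : ℚ) (lam : Fin (size p0) → ℕ) : Fin (size p0) → ℚ :=
  fun j => (-1) ^ r p0 (j.val + 1) * (lam j : ℚ)

/-- The sequences `λ` of non-negative integers with `∑ n_k λ_k = l`. All `n_k` with `k ≥ 1` are
positive, so the bound `λ_k ≤ l` used to enumerate them is automatic, see `mem_states`. -/
noncomputable def states (p0 : ℚ) (l : ℕ) : Finset (Fin (size p0) → ℕ) :=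
  (Fintype.piFinset fun _ => Finset.range (l + 1)).filter
    fun lam => ∑ k : Fin (size p0), n p0 (k.val + 1) * lam k = l

theorem one_le_yShift (p0 : ℚ) (h : 1 ≤ p0) (i : ℕ) :
    1 ≤ yShift p0 (i + 1) ∧ 1 ≤ yShift p0 (i + 2) := by
  induction i with
  | zero =>
    have : 1 ≤ nu p0 0 := by
      simp only [nu, p, div_one]
      exact Nat.le_floor (by simpa using h)
    simpa [yShift] using this
  | succ i ih =>
    refine ⟨ih.2, ?_⟩
    have : yShift p0 (i + 1 + 2) = yShift p0 (i + 1) + nu p0 (i + 1) * yShift p0 (i + 2) := rfl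
    have := ih.1
    omega

theorem one_le_n (p0 : ℚ) (h : 1 ≤ p0) (j : ℕ) : 1 ≤ n p0 (j + 1) := by
  rcases hr : r p0 (j + 1) with _ | i
  · simp [n, hr, m, yShift]
  · have := (one_le_yShift p0 h i).1
    simp only [n, hr]
    omega

theorem mem_states (p0 : ℚ) (h : 1 ≤ p0) (l : ℕ) (lam : Fin (size p0) → ℕ) :
    lam ∈ states p0 l ↔ ∑ k : Fin (size p0), n p0 (k.val + 1) * lam k = l := by
  simp only [states, Finset.mem_filter, Fintype.mem_piFinset, Finset.mem_range,
    and_iff_right_iff_imp]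
  intro hl k
  have h1 := Finset.single_le_sum (f := fun k : Fin (size p0) => n p0 (k.val + 1) * lam k)
    (fun _ _ => Nat.zero_le _) (Finset.mem_univ k)
  have h2 := Nat.le_mul_of_pos_left (lam k) (one_le_n p0 h k)
  simp only [hl] at h1
  omega

/-- The finite `q`-Pochhammer symbol `(x; q)_N = ∏_{0 ≤ k < N} (1 - x q^k)`. -/
noncomputable def qPoch (x q : ℂ) (N : ℕ) : ℂ := ∏ k ∈ Finset.range N, (1 - x * q ^ k)

/-- The infinite `q`-Pochhammer symbol `(x; q)_∞ = ∏_{k ≥ 0} (1 - x q^k)`. -/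
noncomputable def qPochInf (x q : ℂ) : ℂ := ∏' k : ℕ, (1 - x * q ^ k)

/-- The rational power `q^a = exp (a w)` of `q = exp w`, for the logarithm `w` of `q`. -/
noncomputable def qpow (w : ℂ) (a : ℚ) : ℂ := Complex.exp ((a : ℂ) * w)

/-- `V_l^{(p₀)}(q) = ∑_λ q^{λ̃ B λ̃ᵗ / 2} / ∏_j (q^{ε(j)}; q^{ε(j)})_{λ_j}` with
`ε(j) = (-1)^{r(j)}` and `q = exp w`, where the fractional powers of `q` are those given by its
logarithm `w`. -/
noncomputable def V (p0 : ℚ) (l : ℕ) (w : ℂ) : ℂ :=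
  ∑ lam ∈ states p0 l,
    qpow w (1 / 2 * (tilde p0 lam ⬝ᵥ Matrix.mulVec (B p0) (tilde p0 lam))) /
      ∏ j : Fin (size p0), qPoch (qpow w ((-1) ^ r p0 (j.val + 1)))
        (qpow w ((-1) ^ r p0 (j.val + 1))) (lam j)

end XXZ

namespace XXZ
open Finset

/-! For integral `p0 = k` the matrix Θ is explicit: up to signs its entries are min(i, j),
restricted to i, j < k, minus n_i n_j / k. The rank-one part turns into -l²/k in the exponent
(`tilde_form`) and cancels the prefactor q^{l²/k}, so only integral powers of q remain. The last
variable λ_k then occurs only through 1/(q⁻¹; q⁻¹)_{λ_k} = (-1)^λ_k q^{λ_k(λ_k+1)/2}/(q; q)_{λ_k},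
and summing over it gives (q; q)_∞ by Euler (`hasSum_euler`). The other k - 1 variables form an
Andrews–Gordon series.

That series is evaluated along the Bailey chain. The unit Bailey pair (`baileyBeta_unit`) is the
finite triple product at z = 1, z' = q. Each use of `bailey_lemma` multiplies α_s by q^{s²}, and k
uses followed by n → ∞ give (q; q)_∞⁻¹ ∑ q^{k s²} α_s (`tsum_gordonTerm`). The two factors (q; q)_∞
cancel, which leaves the theta series. The Jacobi triple product (`tsum_thetaCoeff`) makes it a
product, and sorting the factors of (q; q)_∞ by residue modulo 2k + 1 gives the last identity. -/

/-! ### Finite q-series: Pochhammer symbols and Gaussian binomials -/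

theorem qPoch_zero (x q : ℂ) : qPoch x q 0 = 1 := by simp [qPoch]

theorem qPoch_succ (x q : ℂ) (n : ℕ) : qPoch x q (n + 1) = qPoch x q n * (1 - x * q ^ n) := by
  simp [qPoch, prod_range_succ]

theorem qPoch_succ' (x q : ℂ) (n : ℕ) : qPoch x q (n + 1) = (1 - x) * qPoch (x * q) q n := by
  rw [qPoch, prod_range_succ', mul_comm, qPoch]
  congr 1
  · simp
  · exact prod_congr rfl fun k _ => by ring

theorem qPoch_add (x q : ℂ) (m n : ℕ) :
    qPoch x q (m + n) = qPoch x q m * qPoch (x * q ^ m) q n := by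
  simp only [qPoch, prod_range_add]
  congr 1
  exact prod_congr rfl fun k _ => by ring

theorem qPoch_ne_zero {x q : ℂ} (hx : ‖x‖ < 1) (hq : ‖q‖ ≤ 1) (n : ℕ) : qPoch x q n ≠ 0 := by
  refine prod_ne_zero_iff.2 fun k _ h => ?_
  have h1 : x * q ^ k = 1 := (sub_eq_zero.1 h).symm
  have h2 : ‖x‖ * ‖q‖ ^ k = 1 := by rw [← norm_pow, ← norm_mul, h1, norm_one]
  have := mul_le_of_le_one_right (norm_nonneg x) (pow_le_one₀ (norm_nonneg q) hq (n := k))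
  linarith

/-- The Gaussian binomial coefficient, by its Pascal recursion. -/
def qBinom (q : ℂ) : ℕ → ℕ → ℂ
  | _, 0 => 1
  | 0, _ + 1 => 0
  | n + 1, k + 1 => q ^ (k + 1) * qBinom q n (k + 1) + qBinom q n k

theorem qBinom_zero_right (q : ℂ) (n : ℕ) : qBinom q n 0 = 1 := by
  cases n <;> rfl

theorem qBinom_eq_zero (q : ℂ) {n k : ℕ} (h : n < k) : qBinom q n k = 0 := by
  induction n generalizing k with
  | zero => obtain ⟨k, rfl⟩ := Nat.exists_eq_succ_of_ne_zero h.ne'; rfl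
  | succ n ih =>
    obtain ⟨k, rfl⟩ := Nat.exists_eq_succ_of_ne_zero (Nat.ne_zero_of_lt h)
    simp only [qBinom]
    rw [ih (by omega), ih (by omega)]
    simp

theorem qBinom_self (q : ℂ) (n : ℕ) : qBinom q n n = 1 := by
  induction n with
  | zero => rfl
  | succ n ih => simp [qBinom, ih, qBinom_eq_zero q (Nat.lt_succ_self n)]

theorem qBinom_mul (q : ℂ) (m k : ℕ) :
    qBinom q (k + m) k * (qPoch q q k * qPoch q q m) = qPoch q q (k + m) := by
  induction k generalizing m with
  | zero => simp [qBinom_zero_right, qPoch_zero]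
  | succ k ihk =>
    induction m with
    | zero => simp [qBinom_self, qPoch_zero]
    | succ m ihm =>
      have h1 : k + 1 + (m + 1) = (k + 1 + m) + 1 := by ring
      have h2 := ihk (m + 1)
      rw [h1, qBinom, qPoch_succ q q (k + 1 + m), ← add_assoc k m 1] at *
      rw [show k + 1 + m = k + m + 1 by ring] at *
      have e : qBinom q (k + m + 1) (k + 1) * (qPoch q q (k + 1) * qPoch q q (m + 1))
          = qPoch q q (k + m + 1) * (1 - q * q ^ m) := by
        rw [qPoch_succ q q m, ← ihm]; ring
      have e' : qBinom q (k + m + 1) k * (qPoch q q (k + 1) * qPoch q q (m + 1))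
          = qPoch q q (k + m + 1) * (1 - q * q ^ k) := by
        rw [qPoch_succ q q k, ← h2]; ring
      rw [add_mul, mul_assoc, e, e']
      ring

theorem qBinom_eq_div {q : ℂ} (hq : ‖q‖ < 1) {n k : ℕ} (h : k ≤ n) :
    qBinom q n k = qPoch q q n / (qPoch q q k * qPoch q q (n - k)) := by
  obtain ⟨m, rfl⟩ := Nat.exists_eq_add_of_le h
  rw [eq_div_iff (mul_ne_zero (qPoch_ne_zero hq hq.le _) (qPoch_ne_zero hq hq.le _)),
    Nat.add_sub_cancel_left, qBinom_mul]

/-- Pascal's rule moved onto the weight `g`; it drives the inductions for the q-binomial and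
q-Vandermonde sums. -/
theorem sum_mul_qBinom_succ (q : ℂ) (g : ℕ → ℂ) (N : ℕ) :
    ∑ t ∈ range (N + 2), g t * qBinom q (N + 1) t =
      ∑ t ∈ range (N + 1), (g t * q ^ t + g (t + 1)) * qBinom q N t := by
  rw [sum_range_succ']
  simp only [qBinom, mul_add, add_mul, sum_add_distrib]
  have h := sum_range_succ' (fun t => g t * q ^ t * qBinom q N t) (N + 1)
  rw [sum_range_succ, qBinom_eq_zero q (Nat.lt_succ_self N)] at h
  simp only [mul_zero, add_zero, pow_zero, mul_one, qBinom_zero_right] at h ⊢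
  rw [h]
  simp only [mul_assoc]
  ring

/-- The finite `q`-binomial theorem in homogeneous form. -/
theorem q_binomial (q x y : ℂ) (N : ℕ) :
    ∑ t ∈ range (N + 1), (-1) ^ t * q ^ (t.choose 2) * x ^ t * y ^ (N - t) * qBinom q N t =
      ∏ j ∈ range N, (y - x * q ^ j) := by
  induction N generalizing x with
  | zero => simp [qBinom]
  | succ N ih =>
    rw [sum_mul_qBinom_succ q (fun t => (-1) ^ t * q ^ (t.choose 2) * x ^ t * y ^ (N + 1 - t)),
      prod_range_succ']
    have h : ∏ j ∈ range N, (y - x * q ^ (j + 1)) = ∏ j ∈ range N, (y - x * q * q ^ j) :=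
      prod_congr rfl fun j _ => by ring
    rw [h, ← ih, sum_mul]
    refine sum_congr rfl fun t ht => ?_
    have ht : t ≤ N := by simpa [Nat.lt_succ_iff] using ht
    rw [Nat.add_sub_add_right, Nat.sub_add_comm ht, Nat.choose_succ_succ' t 1, Nat.choose_one_right]
    ring

/-- A form of the `q`-Vandermonde summation. -/
theorem q_vandermonde (q x : ℂ) (m : ℕ) :
    ∑ t ∈ range (m + 1), q ^ (t ^ 2) * x ^ t * qPoch (x * q ^ (t + 1)) q (m - t) * qBinom q m t =
      1 := by
  induction m generalizing x with
  | zero => simp [qBinom, qPoch]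
  | succ m ih =>
    -- The new weight is the summand at `x * q`: after factoring, the bracket is (1 - x q^{t+1}) + x
    -- q^{t+1} = 1.
    rw [sum_mul_qBinom_succ q
      (fun t => q ^ (t ^ 2) * x ^ t * qPoch (x * q ^ (t + 1)) q (m + 1 - t)), ← ih (x * q)]
    refine sum_congr rfl fun t ht => ?_
    have ht : t ≤ m := by simpa [Nat.lt_succ_iff] using ht
    rw [Nat.succ_sub ht, Nat.succ_sub_succ, qPoch_succ',
      show x * q * q ^ (t + 1) = x * q ^ (t + 1) * q by ring,
      show x * q ^ (t + 1 + 1) = x * q ^ (t + 1) * q by ring]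
    ring

/-- This is `q_vandermonde` at x = q^c, divided by Pochhammer symbols; it is the inner sum in
Bailey's lemma. -/
theorem sum_div_qPoch {q : ℂ} (hq : ‖q‖ < 1) (m c : ℕ) :
    ∑ t ∈ range (m + 1), q ^ (t * (t + c)) /
        (qPoch q q (m - t) * qPoch q q t * qPoch q q (t + c)) =
      1 / (qPoch q q m * qPoch q q (m + c)) := by
  have hP := qPoch_ne_zero hq hq.le
  rw [eq_div_iff (mul_ne_zero (hP _) (hP _)), ← q_vandermonde q (q ^ c) m, sum_mul]
  refine sum_congr rfl fun t ht => ?_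
  have ht : t ≤ m := by simpa [Nat.lt_succ_iff] using ht
  have h1 : qPoch q q (m + c) = qPoch q q (t + c) * qPoch (q ^ c * q ^ (t + 1)) q (m - t) := by
    rw [show m + c = t + c + (m - t) by omega, qPoch_add]
    congr 2
    ring
  rw [qBinom_eq_div hq ht, h1]
  have := hP (m - t); have := hP t; have := hP (t + c)
  field_simp
  ring

/-! ### Bailey's lemma and the finite triple product -/

/-- The sequence `β` of the Bailey pair relative to `1` with the given sequence `α`. -/
noncomputable def baileyBeta (q : ℂ) (a : ℕ → ℂ) (n : ℕ) : ℂ :=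
  ∑ s ∈ range (n + 1), a s / (qPoch q q (n - s) * qPoch q q (n + s))

/-- The limiting case of Bailey's lemma. -/
theorem bailey_lemma {q : ℂ} (hq : ‖q‖ < 1) (a : ℕ → ℂ) (n : ℕ) :
    ∑ s ∈ range (n + 1), q ^ (s ^ 2) * baileyBeta q a s / qPoch q q (n - s) =
      baileyBeta q (fun s => q ^ (s ^ 2) * a s) n := by
  have hP := qPoch_ne_zero hq hq.le
  simp only [baileyBeta, mul_sum, sum_div]
  rw [sum_comm' (t' := range (n + 1)) (s' := fun u => Ico u (n + 1))
    (by intro x y; simp only [mem_range, mem_Ico]; omega)]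
  refine sum_congr rfl fun u hu => ?_
  have hu : u ≤ n := by simpa [Nat.lt_succ_iff] using hu
  -- With s = u + t one has s² = u² + t(t + 2u), hence the shift `2 * u`.
  have h := sum_div_qPoch hq (n - u) (2 * u)
  rw [show n - u + 2 * u = n + u by omega] at h
  rw [sum_Ico_eq_sum_range, mul_div_assoc, ← mul_one_div (a u), ← h, show n + 1 - u = n - u + 1 by omega,
    mul_sum, mul_sum]
  refine sum_congr rfl fun t ht => ?_
  have ht : t ≤ n - u := by simpa [Nat.lt_succ_iff] using ht
  rw [show n - (u + t) = n - u - t by omega, show u + t - u = t by omega,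
    show u + t + u = t + 2 * u by ring]
  have := hP (n - u - t); have := hP t; have := hP (t + 2 * u)
  field_simp
  ring

theorem sum_range_two_mul_succ (f : ℕ → ℂ) (n : ℕ) :
    ∑ t ∈ range (2 * n + 1), f t = f n + ∑ s ∈ range n, (f (n + (s + 1)) + f (n - (s + 1))) := by
  rw [show 2 * n + 1 = n + (n + 1) by ring, sum_range_add, sum_range_succ', sum_add_distrib,
    ← sum_range_reflect]
  simp only [show ∀ j, n - 1 - j = n - (j + 1) by intro j; omega]
  simp
  ring

/-- The sequence `1, -(z + z'), Q (z² + z'²), -Q³ (z³ + z'³), …`. -/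
noncomputable def thetaCoeff (Q z z' : ℂ) (s : ℕ) : ℂ :=
  if s = 0 then 1 else (-1) ^ s * Q ^ (s.choose 2) * (z ^ s + z' ^ s)

theorem choose_two_add (a b : ℕ) : (a + b).choose 2 = a.choose 2 + a * b + b.choose 2 := by
  induction b with
  | zero => simp
  | succ b ih =>
    rw [← add_assoc, Nat.choose_succ_succ' (a + b) 1, Nat.choose_succ_succ' b 1, ih,
      Nat.choose_one_right, Nat.choose_one_right]
    ring

theorem two_mul_choose_two (s : ℕ) : 2 * s.choose 2 + s = s ^ 2 := by
  induction s with
  | zero => simp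
  | succ s ih =>
    rw [Nat.choose_succ_succ' s 1, Nat.choose_one_right]
    nlinarith

theorem prod_pow_id (Q : ℂ) (n : ℕ) : ∏ j ∈ range n, Q ^ j = Q ^ n.choose 2 := by
  rw [prod_pow_eq_pow_sum, sum_range_id, Nat.choose_two_right]

/-- The finite form of the Jacobi triple product. -/
theorem finite_triple_product {Q z z' : ℂ} (hQ : ‖Q‖ < 1) (hQ0 : Q ≠ 0) (hz : z * z' = Q) (n : ℕ) :
    qPoch Q Q (2 * n) * baileyBeta Q (thetaCoeff Q z z') n = qPoch z Q n * qPoch z' Q n := by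
  have hP := qPoch_ne_zero hQ hQ.le
  have hz0 : z ≠ 0 := by rintro rfl; simp at hz; exact hQ0 hz.symm
  -- In the q-binomial theorem with x = z, y = Q^n, N = 2n, the first n factors are -z Q^j (1 - z'
  -- Q^{n-1-j}) and the last n are Q^n (1 - z Q^j); `K` collects the monomials.
  set K : ℂ := (-z) ^ n * Q ^ (n.choose 2 + n ^ 2) with hK
  have hK0 : K ≠ 0 := mul_ne_zero (pow_ne_zero _ (neg_ne_zero.2 hz0)) (pow_ne_zero _ hQ0)
  have hprod : ∏ j ∈ range (2 * n), (Q ^ n - z * Q ^ j) = K * (qPoch z Q n * qPoch z' Q n) := by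
    rw [two_mul, prod_range_add]
    have h1 : ∏ j ∈ range n, (Q ^ n - z * Q ^ j) = (-z) ^ n * Q ^ n.choose 2 * qPoch z' Q n := by
      rw [← prod_pow_id, qPoch, ← prod_range_reflect (fun k => 1 - z' * Q ^ k)]
      rw [show (-z) ^ n = ∏ _j ∈ range n, (-z) by simp, ← prod_mul_distrib, ← prod_mul_distrib]
      refine prod_congr rfl fun j hj => ?_
      have hj : j < n := by simpa using hj
      have : Q ^ n = Q ^ j * Q ^ (n - 1 - j) * (z * z') := by
        rw [hz, ← pow_add, ← pow_succ]; congr 1; omega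
      rw [this]; ring
    have h2 : ∏ j ∈ range n, (Q ^ n - z * Q ^ (n + j)) = Q ^ (n ^ 2) * qPoch z Q n := by
      rw [sq, pow_mul, show (Q ^ n) ^ n = ∏ _j ∈ range n, Q ^ n by simp, qPoch, ← prod_mul_distrib]
      exact prod_congr rfl fun j _ => by ring
    rw [h1, h2, hK]; ring
  refine mul_left_cancel₀ hK0 ?_
  rw [← hprod, ← q_binomial, sum_range_two_mul_succ, baileyBeta, sum_range_succ', mul_add, mul_add,
    add_comm, mul_sum, mul_sum]
  congr 1
  · rw [qBinom_eq_div hQ (by omega), show 2 * n - n = n by omega, thetaCoeff, if_pos rfl, hK]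
    simp only [Nat.sub_zero, add_zero]
    rw [neg_pow z]
    ring
  · refine sum_congr rfl fun u hu => ?_
    have hu : u < n := by simpa using hu
    generalize hs : u + 1 = s
    obtain ⟨d, rfl⟩ : ∃ d, n = d + s := Nat.exists_eq_add_of_le' (by omega)
    rw [qBinom_eq_div hQ (by omega), qBinom_eq_div hQ (by omega), thetaCoeff,
      if_neg (by omega)]
    rw [show 2 * (d + s) - (d + s + s) = d by omega, show d + s - s = d by omega,
      show 2 * (d + s) - d = d + s + s by omega]
    -- Exponents of Q in the terms t = n + s and t = n - s, where n = d + s. The surplus Q^s in the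
    -- second is (z z')^s, which turns z^{n-s} into z^n z'^s.
    have e1 : (d + s + s).choose 2 + (d + s) * d = (d + s).choose 2 + (d + s) ^ 2 + s.choose 2 := by
      rw [choose_two_add (d + s) s]; ring
    have e2 : d.choose 2 + (d + s) * (d + s + s) =
        (d + s).choose 2 + (d + s) ^ 2 + s.choose 2 + s := by
      have := two_mul_choose_two s
      rw [choose_two_add d s]; nlinarith
    have f1 : (-1 : ℂ) ^ (d + s + s) * Q ^ ((d + s + s).choose 2) * z ^ (d + s + s) * (Q ^ (d + s)) ^ d
        = K * ((-1) ^ s * Q ^ (s.choose 2) * z ^ s) := by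
      rw [← pow_mul, hK, show (-1 : ℂ) ^ (d + s + s) * Q ^ ((d + s + s).choose 2) * z ^ (d + s + s) *
        Q ^ ((d + s) * d) = (-1 : ℂ) ^ (d + s + s) * z ^ (d + s + s) *
        Q ^ ((d + s + s).choose 2 + (d + s) * d) by ring, e1, neg_pow z]
      ring
    have f2 : (-1 : ℂ) ^ d * Q ^ (d.choose 2) * z ^ d * (Q ^ (d + s)) ^ (d + s + s)
        = K * ((-1) ^ s * Q ^ (s.choose 2) * z' ^ s) := by
      have hs1 : (-1 : ℂ) ^ s * (-1) ^ s = 1 := by rw [← mul_pow]; simp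
      have hs2 : Q ^ s = z ^ s * z' ^ s := by rw [← mul_pow, hz]
      rw [← pow_mul, hK, show (-1 : ℂ) ^ d * Q ^ (d.choose 2) * z ^ d * Q ^ ((d + s) * (d + s + s))
        = (-1 : ℂ) ^ d * z ^ d * Q ^ (d.choose 2 + (d + s) * (d + s + s)) by ring, e2, neg_pow z,
        pow_add Q _ s, hs2, pow_add (-1 : ℂ) d s]
      linear_combination (-(-1 : ℂ) ^ d * z ^ (d + s) * z' ^ s *
        Q ^ ((d + s).choose 2 + (d + s) ^ 2 + s.choose 2)) * hs1
    rw [f1, f2]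
    ring

/-! ### Passage to the limit, triple product and Euler's series -/

open Filter Topology

/-- Tannery's theorem: extend the sums by zero beyond n and dominate by `‖f t‖ * C`. -/
theorem tendsto_sum_range_mul {f : ℕ → ℂ} (hf : Summable fun t => ‖f t‖) {g : ℕ → ℕ → ℂ} {C : ℝ}
    (hC : ∀ n t, ‖g n t‖ ≤ C) {L : ℂ} (hg : ∀ t, Tendsto (fun n => g n t) atTop (𝓝 L)) :
    Tendsto (fun n => ∑ t ∈ range (n + 1), f t * g n t) atTop (𝓝 ((∑' t, f t) * L)) := by
  have h := tendsto_tsum_of_dominated_convergence (𝓕 := atTop)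
    (f := fun n t => if t ∈ range (n + 1) then f t * g n t else 0) (g := fun t => f t * L)
    (bound := fun t => ‖f t‖ * C) (hf.mul_right C) ?_ ?_
  · rw [tsum_mul_right] at h
    refine h.congr fun n => ?_
    rw [tsum_eq_sum (s := range (n + 1)) (fun t ht => if_neg ht)]
    exact sum_congr rfl fun t ht => if_pos ht
  · intro t
    refine ((hg t).const_mul (f t)).congr' ?_
    filter_upwards [eventually_ge_atTop t] with n hn
    rw [if_pos (mem_range.2 (by omega))]
  · refine Eventually.of_forall fun n t => ?_
    have h0 : 0 ≤ C := (norm_nonneg _).trans (hC 0 0)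
    split_ifs
    · rw [norm_mul]
      exact mul_le_mul_of_nonneg_left (hC n t) (norm_nonneg _)
    · rw [norm_zero]
      positivity

theorem summable_norm_mul_pow (x : ℂ) {q : ℂ} (hq : ‖q‖ < 1) : Summable fun k : ℕ => ‖-(x * q ^ k)‖ := by
  simp only [norm_neg, norm_mul, norm_pow]
  exact (summable_geometric_of_lt_one (norm_nonneg q) hq).mul_left _

theorem multipliable_qPoch (x : ℂ) {q : ℂ} (hq : ‖q‖ < 1) :
    Multipliable fun k : ℕ => 1 - x * q ^ k := by
  simpa only [sub_eq_add_neg] using multipliable_one_add_of_summable (summable_norm_mul_pow x hq)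

theorem tendsto_qPoch (x : ℂ) {q : ℂ} (hq : ‖q‖ < 1) :
    Tendsto (qPoch x q) atTop (𝓝 (qPochInf x q)) :=
  (multipliable_qPoch x hq).hasProd.tendsto_prod_nat

theorem qPochInf_ne_zero {x q : ℂ} (hx : ‖x‖ < 1) (hq : ‖q‖ < 1) : qPochInf x q ≠ 0 := by
  have h := tprod_one_add_ne_zero_of_summable (f := fun k : ℕ => -(x * q ^ k)) ?_
    (summable_norm_mul_pow x hq)
  · simpa only [qPochInf, sub_eq_add_neg] using h
  · intro k hk
    have := qPoch_ne_zero hx hq.le (k + 1)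
    rw [qPoch_succ] at this
    exact right_ne_zero_of_mul this (by rw [sub_eq_add_neg, hk])

/-- The inverses converge because the limit (q; q)_∞ is nonzero, so they are bounded; this is the
uniform bound for all the dominations. -/
theorem exists_norm_inv_qPoch_le {q : ℂ} (hq : ‖q‖ < 1) :
    ∃ C : ℝ, 1 ≤ C ∧ ∀ n, ‖(qPoch q q n)⁻¹‖ ≤ C := by
  have h := ((tendsto_qPoch q hq).inv₀ (qPochInf_ne_zero hq hq)).norm.bddAbove_range
  obtain ⟨C, hC⟩ := h
  have h1 : ∀ n, ‖(qPoch q q n)⁻¹‖ ≤ C := fun n => hC ⟨n, rfl⟩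
  exact ⟨C, by simpa [qPoch_zero] using h1 0, h1⟩

theorem tendsto_sum_div_qPoch {q : ℂ} (hq : ‖q‖ < 1) {f : ℕ → ℂ} (hf : Summable fun t => ‖f t‖) :
    Tendsto (fun n => ∑ t ∈ range (n + 1), f t / qPoch q q (n - t)) atTop
      (𝓝 ((∑' t, f t) * (qPochInf q q)⁻¹)) := by
  obtain ⟨C, -, hC⟩ := exists_norm_inv_qPoch_le hq
  exact tendsto_sum_range_mul hf (g := fun n t => (qPoch q q (n - t))⁻¹) (fun n t => hC _)
    fun t => ((tendsto_qPoch q hq).inv₀ (qPochInf_ne_zero hq hq)).comp (tendsto_sub_atTop_nat t)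

theorem tendsto_baileyBeta {q : ℂ} (hq : ‖q‖ < 1) {a : ℕ → ℂ} (ha : Summable fun t => ‖a t‖) :
    Tendsto (baileyBeta q a) atTop
      (𝓝 ((∑' t, a t) * ((qPochInf q q)⁻¹ * (qPochInf q q)⁻¹))) := by
  obtain ⟨C, hC1, hC⟩ := exists_norm_inv_qPoch_le hq
  have h := tendsto_sum_range_mul ha
    (g := fun n t => (qPoch q q (n - t))⁻¹ * (qPoch q q (n + t))⁻¹) (C := C * C)
    (L := (qPochInf q q)⁻¹ * (qPochInf q q)⁻¹) ?_ ?_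
  · refine h.congr fun n => ?_
    exact sum_congr rfl fun t _ => by rw [div_eq_mul_inv, mul_inv]
  · intro n t
    rw [norm_mul]
    exact mul_le_mul (hC _) (hC _) (norm_nonneg _) (by linarith)
  · intro t
    have h1 := (tendsto_qPoch q hq).inv₀ (qPochInf_ne_zero hq hq)
    exact (h1.comp (tendsto_sub_atTop_nat t)).mul (h1.comp (tendsto_add_atTop_nat t))

theorem summable_thetaCoeff {Q z z' : ℂ} (hQ : ‖Q‖ < 1) (hz : ‖z‖ ≤ 1) (hz' : ‖z'‖ ≤ 1) :
    Summable fun s => ‖thetaCoeff Q z z' s‖ := by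
  rw [← summable_nat_add_iff 1]
  refine Summable.of_nonneg_of_le (fun _ => norm_nonneg _) (fun s => ?_)
    ((summable_geometric_of_lt_one (norm_nonneg Q) hQ).mul_right 2)
  rw [thetaCoeff, if_neg (by omega)]
  simp only [norm_mul, norm_pow, norm_neg, norm_one, one_pow, one_mul]
  refine mul_le_mul (pow_le_pow_of_le_one (norm_nonneg Q) hQ.le ?_) ?_ (norm_nonneg _) (by positivity)
  · rw [Nat.choose_succ_succ' s 1, Nat.choose_one_right]
    omega
  · refine (norm_add_le _ _).trans ?_
    have h1 : ‖z ^ (s + 1)‖ ≤ 1 := by rw [norm_pow]; exact pow_le_one₀ (norm_nonneg z) hz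
    have h2 : ‖z' ^ (s + 1)‖ ≤ 1 := by rw [norm_pow]; exact pow_le_one₀ (norm_nonneg z') hz'
    linarith

/-- The Jacobi triple product. -/
theorem tsum_thetaCoeff {Q z z' : ℂ} (hQ : ‖Q‖ < 1) (hQ0 : Q ≠ 0) (h : z * z' = Q)
    (hz : ‖z‖ ≤ 1) (hz' : ‖z'‖ ≤ 1) :
    ∑' s, thetaCoeff Q z z' s = qPochInf Q Q * qPochInf z Q * qPochInf z' Q := by
  have h1 := (((tendsto_qPoch Q hQ).comp (tendsto_id.const_mul_atTop' (r := 2) (by norm_num))).mul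
    (tendsto_baileyBeta hQ (summable_thetaCoeff hQ hz hz'))).congr
    fun n => finite_triple_product hQ hQ0 h n
  have h2 := tendsto_nhds_unique h1 ((tendsto_qPoch z hQ).mul (tendsto_qPoch z' hQ))
  have := qPochInf_ne_zero hQ hQ
  field_simp at h2
  rw [h2]

/-- At z = 1 the factor (1; q)_n of the finite triple product vanishes for n > 0. -/
theorem baileyBeta_unit {q : ℂ} (hq : ‖q‖ < 1) (hq0 : q ≠ 0) (n : ℕ) :
    baileyBeta q (thetaCoeff q 1 q) n = if n = 0 then 1 else 0 := by
  have h := finite_triple_product hq hq0 (one_mul q) n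
  have hP := qPoch_ne_zero hq hq.le (2 * n)
  rcases n with _ | n
  · simpa [qPoch_zero] using h
  · rw [qPoch_succ' 1] at h
    simpa [hP] using h

/-- The q-binomial theorem at x = q, y = 1, divided by (q; q)_N, says that the convolution of this
series with 1/(q; q)_{N-t} is constantly 1; let N → ∞. -/
theorem hasSum_euler {q : ℂ} (hq : ‖q‖ < 1) :
    (Summable fun m : ℕ => ‖(-1) ^ m * q ^ (m.choose 2 + m) / qPoch q q m‖) ∧
      ∑' m : ℕ, (-1) ^ m * q ^ (m.choose 2 + m) / qPoch q q m = qPochInf q q := by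
  have hP := qPoch_ne_zero hq hq.le
  have hs : Summable fun m : ℕ => ‖(-1) ^ m * q ^ (m.choose 2 + m) / qPoch q q m‖ := by
    obtain ⟨C, hC1, hC⟩ := exists_norm_inv_qPoch_le hq
    refine Summable.of_nonneg_of_le (fun _ => norm_nonneg _) (fun m => ?_)
      ((summable_geometric_of_lt_one (norm_nonneg q) hq).mul_right C)
    rw [div_eq_mul_inv]
    simp only [norm_mul (_ * _), norm_mul, norm_pow, norm_neg, norm_one, one_pow, one_mul]
    refine mul_le_mul (pow_le_pow_of_le_one (norm_nonneg q) hq.le ?_) (hC m) (norm_nonneg _)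
      (by positivity)
    omega
  refine ⟨hs, ?_⟩
  have h1 := tendsto_sum_div_qPoch hq hs
  have h2 := tendsto_nhds_unique (h1.congr (f₂ := fun _ => 1) fun N => ?_) tendsto_const_nhds
  · have := qPochInf_ne_zero hq hq
    field_simp at h2
    exact h2
  · have hb := q_binomial q q 1 N
    have hN : ∏ j ∈ range N, (1 - q * q ^ j) = qPoch q q N := rfl
    rw [hN] at hb
    have hb1 := congrArg (· / qPoch q q N) hb
    simp only [div_self (hP N), sum_div] at hb1
    refine Eq.trans ?_ hb1
    refine sum_congr rfl fun t ht => ?_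
    have ht : t ≤ N := by simpa [Nat.lt_succ_iff] using ht
    rw [qBinom_eq_div hq ht, one_pow]
    have := hP t; have := hP (N - t); have := hP N
    field_simp
    ring

/-! ### The Andrews–Gordon series -/

/-- The summand of the Andrews–Gordon series with `d` summation variables. -/
noncomputable def gordonTerm (q : ℂ) {d : ℕ} (lam : Fin d → ℕ) : ℂ :=
  q ^ (∑ i : Fin d, ∑ j : Fin d, (min i.val j.val + 1) * (lam i * lam j)) /
    ∏ i, qPoch q q (lam i)

/-- Lowering every coefficient min + 1 by one removes the square of the total and leaves the same
form in the tail. Iterated, this gives the usual exponent N₁² + N₂² + ⋯. -/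
theorem sum_min_cons {d : ℕ} (a : ℕ) (lam : Fin d → ℕ) :
    ∑ i : Fin (d + 1), ∑ j : Fin (d + 1), (min i.val j.val + 1) *
        ((Fin.cons a lam : Fin (d + 1) → ℕ) i * (Fin.cons a lam : Fin (d + 1) → ℕ) j) =
      (a + ∑ i, lam i) ^ 2 +
        ∑ i : Fin d, ∑ j : Fin d, (min i.val j.val + 1) * (lam i * lam j) := by
  simp only [Fin.sum_univ_succ, Fin.cons_zero, Fin.cons_succ, Fin.val_zero, Fin.val_succ,
    Nat.zero_min, Nat.min_zero, Nat.succ_min_succ, Nat.succ_eq_add_one, one_mul, sum_add_distrib, add_mul,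
    ← mul_sum, ← sum_mul]
  ring

theorem gordonTerm_cons (q : ℂ) {d : ℕ} (a : ℕ) (lam : Fin d → ℕ) :
    gordonTerm q (Fin.cons a lam : Fin (d + 1) → ℕ) =
      q ^ ((a + ∑ i, lam i) ^ 2) * (gordonTerm q lam / qPoch q q a) := by
  rw [gordonTerm, sum_min_cons, gordonTerm, Fin.prod_univ_succ, pow_add]
  simp only [Fin.cons_zero, Fin.cons_succ]
  rw [div_div, mul_div_assoc, mul_comm (qPoch q q a)]

/-- The part of the Andrews–Gordon series with `λ₁ + ⋯ + λ_d = N`. -/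
noncomputable def gordonSum (q : ℂ) (d N : ℕ) : ℂ :=
  ∑ lam ∈ Nat.antidiagonalTuple d N, gordonTerm q lam

theorem gordonSum_zero (q : ℂ) (N : ℕ) : gordonSum q 0 N = if N = 0 then 1 else 0 := by
  rcases N with _ | N
  · simp [gordonSum, gordonTerm]
  · simp [gordonSum]

theorem gordonSum_succ (q : ℂ) (d N : ℕ) :
    gordonSum q (d + 1) N =
      q ^ (N ^ 2) * ∑ M ∈ range (N + 1), gordonSum q d M / qPoch q q (N - M) := by
  simp only [gordonSum, sum_div, mul_sum, sum_sigma']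
  refine sum_bij' (i := fun lam _ => ⟨∑ i : Fin d, lam i.succ, fun i => lam i.succ⟩)
    (j := fun x _ => Fin.cons (N - x.1) x.2) ?_ ?_ ?_ ?_ ?_
  · intro lam h
    rw [Nat.mem_antidiagonalTuple, Fin.sum_univ_succ] at h
    simp only [mem_sigma, mem_range, Nat.mem_antidiagonalTuple, and_true]
    omega
  · rintro ⟨M, lam⟩ h
    simp only [mem_sigma, mem_range, Nat.mem_antidiagonalTuple] at h
    rw [Nat.mem_antidiagonalTuple, Fin.sum_univ_succ]
    simp only [Fin.cons_zero, Fin.cons_succ, h.2]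
    omega
  · intro lam h
    rw [Nat.mem_antidiagonalTuple, Fin.sum_univ_succ] at h
    refine funext fun i => ?_
    refine Fin.cases ?_ (fun i => ?_) i
    · simp only [Fin.cons_zero]; omega
    · simp
  · rintro ⟨M, lam⟩ h
    simp only [mem_sigma, mem_range, Nat.mem_antidiagonalTuple] at h
    obtain ⟨h1, rfl⟩ := h
    simp
  · intro lam h
    rw [Nat.mem_antidiagonalTuple, Fin.sum_univ_succ] at h
    have h0 : N - ∑ i : Fin d, lam i.succ = lam 0 := by omega
    simp only [h0]
    conv_lhs => rw [← Fin.cons_self_tail lam]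
    rw [gordonTerm_cons]
    simp only [Fin.tail, h]
    rfl

/-- Each summation variable is one step of the Bailey chain. The case `d = 0` already uses one step,
hence the exponent `d + 1`. -/
theorem sum_gordonSum_div {q : ℂ} (hq : ‖q‖ < 1) (hq0 : q ≠ 0) (d N : ℕ) :
    ∑ M ∈ range (N + 1), gordonSum q d M / qPoch q q (N - M) =
      baileyBeta q (fun s => q ^ ((d + 1) * s ^ 2) * thetaCoeff q 1 q s) N := by
  induction d generalizing N with
  | zero =>
    simp only [zero_add, one_mul]
    rw [← bailey_lemma hq]
    refine sum_congr rfl fun M _ => ?_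
    rw [gordonSum_zero, baileyBeta_unit hq hq0]
    rcases M with _ | M <;> simp
  | succ d ih =>
    simp only [gordonSum_succ, ih]
    rw [bailey_lemma hq]
    congr 1
    ext s
    ring

/-- Regroups a summable family by an integer weight: the total ∑ λ_i for the Gordon sums, and ∑ n_k
λ_k for V_l. -/
theorem hasSum_sum_fiber {ι : Type*} {F : ι → ℂ} (hF : Summable F) (wt : ι → ℕ)
    (s : ℕ → Finset ι) (hs : ∀ l i, i ∈ s l ↔ wt i = l) :
    HasSum (fun l => ∑ i ∈ s l, F i) (∑' i, F i) := by
  have h := (Equiv.sigmaFiberEquiv wt).hasSum_iff.2 hF.hasSum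
  refine h.sigma fun l => ?_
  have h2 := hasSum_fintype (fun i : {i // i ∈ s l} => F i)
  rw [univ_eq_attach, sum_attach] at h2
  exact ((Equiv.subtypeEquivRight (hs l)).hasSum_iff).1 h2

theorem summable_prod_fin {g : ℕ → ℝ} (hg : Summable g) (h0 : ∀ n, 0 ≤ g n) (d : ℕ) :
    Summable fun lam : Fin d → ℕ => ∏ i, g (lam i) := by
  induction d with
  | zero => exact Summable.of_finite
  | succ d ih =>
    rw [← (Fin.consEquiv fun _ : Fin (d + 1) => ℕ).summable_iff]
    refine (hg.mul_of_nonneg ih h0 fun lam => prod_nonneg fun i _ => h0 _).congr fun x => ?_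
    simp [Fin.prod_univ_succ, Fin.consEquiv]

theorem summable_gordonTerm {q : ℂ} (hq : ‖q‖ < 1) (d : ℕ) :
    Summable fun lam : Fin d → ℕ => ‖gordonTerm q lam‖ := by
  obtain ⟨C, hC1, hC⟩ := exists_norm_inv_qPoch_le hq
  refine Summable.of_nonneg_of_le (fun _ => norm_nonneg _) (fun lam => ?_)
    (summable_prod_fin ((summable_geometric_of_lt_one (norm_nonneg q) hq).mul_right C)
      (fun n => by positivity) d)
  rw [gordonTerm, div_eq_mul_inv, ← prod_inv_distrib, norm_mul, norm_pow, norm_prod,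
    prod_mul_distrib, prod_pow_eq_pow_sum]
  refine mul_le_mul (pow_le_pow_of_le_one (norm_nonneg q) hq.le (sum_le_sum fun i _ => ?_))
    (prod_le_prod (fun _ _ => norm_nonneg _) fun i _ => hC _)
    (prod_nonneg fun _ _ => norm_nonneg _) (by positivity)
  -- The diagonal term alone suffices, since λ_i ≤ λ_i².
  refine le_trans ?_ (single_le_sum (f := fun j : Fin d => (min i.val j.val + 1) * (lam i * lam j))
    (fun _ _ => Nat.zero_le _) (mem_univ i))
  nlinarith [Nat.le_mul_self (lam i), Nat.zero_le (min i.val i.val * (lam i * lam i))]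

/-- The Andrews–Gordon series as a theta series. -/
theorem tsum_gordonTerm {q : ℂ} (hq : ‖q‖ < 1) (hq0 : q ≠ 0) (d : ℕ) :
    (∑' lam : Fin d → ℕ, gordonTerm q lam) * qPochInf q q =
      ∑' s : ℕ, q ^ ((d + 1) * s ^ 2) * thetaCoeff q 1 q s := by
  have h1 : HasSum (gordonSum q d) _ := hasSum_sum_fiber (summable_gordonTerm hq d).of_norm
    (fun lam => ∑ i, lam i) (Nat.antidiagonalTuple d) fun l lam => Nat.mem_antidiagonalTuple
  have h2 := tendsto_sum_div_qPoch hq h1.summable.norm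
  simp only [sum_gordonSum_div hq hq0] at h2
  have h3 := tendsto_baileyBeta hq (a := fun s => q ^ ((d + 1) * s ^ 2) * thetaCoeff q 1 q s) <|
    Summable.of_nonneg_of_le (fun _ => norm_nonneg _) (fun s => by
      rw [norm_mul, norm_pow]
      exact mul_le_of_le_one_left (norm_nonneg _) (pow_le_one₀ (norm_nonneg q) hq.le))
      (summable_thetaCoeff hq norm_one.le hq.le)
  -- One limit carries (q; q)_∞⁻¹, the other its square.
  have h4 := tendsto_nhds_unique h2 h3
  have := qPochInf_ne_zero hq hq
  rw [h1.tsum_eq] at h4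
  field_simp at h4
  exact h4

/-! ### The matrix Θ for integral p₀ -/

theorem p_two_natCast (k : ℕ) : p (k : ℚ) 2 = 0 := by simp [p]

theorem alpha_natCast (k : ℕ) : alpha (k : ℚ) = 0 :=
  Nat.sInf_eq_zero.2 (Or.inl (p_two_natCast k))

theorem m_one_natCast (k : ℕ) : m (k : ℚ) 1 = k := by simp [m, nu, p]

theorem size_natCast (k : ℕ) : size (k : ℚ) = k := by
  rw [size, alpha_natCast, zero_add, m_one_natCast]

theorem r_natCast (k j : ℕ) : r (k : ℚ) j = if k ≤ j then 1 else 0 := by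
  rw [r, alpha_natCast, zero_add, Icc_self, filter_singleton, m_one_natCast]
  split_ifs <;> simp

theorem n_natCast (k j : ℕ) : n (k : ℚ) j = if j < k then j else 1 + (j - k) * k := by
  rw [n, r_natCast]
  by_cases h : k ≤ j
  · simp only [if_pos h, if_neg h.not_gt, m_one_natCast]
    simp [yShift, nu, p]
  · simp [if_neg h, if_pos (not_le.1 h), yShift, m]

/-- Written as a sum of three bands, so that row sums collapse to single terms. -/
theorem c_natCast {k i j : ℕ} (hi : i < k) (hj : j < k) :
    c (k : ℚ) (i + 1) (j + 1) =
      (if i = j then (if j + 1 = k then -1 else if j + 2 = k then 1 else 2) else 0) +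
      (if i + 1 = j then (if j + 1 = k then 1 else -1) else 0) +
      (if i = j + 1 then (if i + 1 = k then 1 else -1) else 0) := by
  have h1 : (-1 : ℚ) ^ r (k : ℚ) (j + 1) = if j + 1 = k then -1 else 1 := by
    rw [r_natCast]
    split_ifs <;> first | omega | norm_num
  have h2 : ¬ j + 1 = k → (j + 1 + 1 = m (k : ℚ) (r (k : ℚ) (j + 1) + 1) ↔ j + 2 = k) := by
    intro h
    rw [r_natCast, if_neg (by omega), zero_add, m_one_natCast]
  have h3 : i = j + 1 → (-1 : ℚ) ^ (r (k : ℚ) (i + 1) + 1) = if k ≤ i + 1 then 1 else -1 := by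
    intro h
    rw [r_natCast]
    split_ifs <;> simp
  rw [c, size_natCast, alpha_natCast, pow_succ (-1 : ℚ) (r (k : ℚ) (j + 1)), h1]
  rcases lt_trichotomy i j with h | rfl | h
  · rw [if_neg (by omega), if_neg (by omega : ¬ i = j), if_neg (by omega : ¬ i = j + 1),
      if_neg (by omega : ¬ j + 1 + 1 = i + 1)]
    by_cases h' : i + 1 = j
    · rw [if_pos (by omega), if_pos h']
      split_ifs <;> norm_num
    · rw [if_neg (by omega), if_neg h']
      norm_num
  · rw [if_pos rfl, if_pos rfl, if_neg (by omega : ¬ i + 1 = i), if_neg (by omega : ¬ i = i + 1)]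
    by_cases h' : i + 1 = k
    · simp [h']
    · simp only [h', if_false, h2 h']
      split_ifs <;> norm_num
  · rw [if_neg (by omega), if_neg (by omega : ¬ i = j), if_neg (by omega : ¬ i + 1 = j),
      if_neg (by omega : ¬ i + 1 + 1 = j + 1)]
    by_cases h' : i = j + 1
    · rw [if_pos (by omega), if_pos h', h3 h']
      by_cases h'' : i + 1 = k
      · simp [h'']
      · simp [h'', show ¬ k ≤ i + 1 by omega]
    · rw [if_neg (by omega), if_neg h']
      norm_num

/-- The sign `(-1)^{r(j+1)}` for integral `p₀ = k`. -/
def sgn (k j : ℕ) : ℚ := if j + 1 = k then -1 else 1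

/-- The entries of the matrix `Θ` for integral `p₀ = k`. -/
noncomputable def thetaEntry (k i j : ℕ) : ℚ :=
  sgn k i * sgn k j * ((if i + 1 < k ∧ j + 1 < k then ((min i j + 1 : ℕ) : ℚ) else 0) -
    (n (k : ℚ) (i + 1) : ℚ) * (n (k : ℚ) (j + 1) : ℚ) / k)

/-- The value at `i` of the product of `Θ⁻¹` with the vector `f`, for integral `p₀ = k`. -/
def rowForm (k : ℕ) (f : ℕ → ℚ) (i : ℕ) : ℚ :=
  (if i + 1 = k then -1 else if i + 2 = k then 1 else 2) * f i +
    (if i + 1 < k then (if i + 2 = k then 1 else -1) * f (i + 1) else 0) +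
    (if 0 < i then (if i + 1 = k then 1 else -1) * f (i - 1) else 0)

theorem sum_c_mul {k i : ℕ} (hi : i < k) (f : ℕ → ℚ) :
    ∑ j ∈ range k, c (k : ℚ) (i + 1) (j + 1) * f j = rowForm k f i := by
  have h : ∀ j ∈ range k, c (k : ℚ) (i + 1) (j + 1) * f j =
      (if i = j then (if j + 1 = k then -1 else if j + 2 = k then 1 else 2) * f j else 0) +
      (if i + 1 = j then (if j + 1 = k then 1 else -1) * f j else 0) +
      (if i = j + 1 then (if i + 1 = k then 1 else -1) * f j else 0) := by
    intro j hj
    rw [c_natCast hi (mem_range.1 hj), add_mul, add_mul]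
    simp only [ite_mul, zero_mul]
  rw [sum_congr rfl h, sum_add_distrib, sum_add_distrib, sum_ite_eq, sum_ite_eq, rowForm,
    if_pos (mem_range.2 hi)]
  simp only [mem_range]
  congr 1
  rcases i with _ | i
  · simp
  · simp only [add_left_inj]
    rw [sum_ite_eq, if_pos (mem_range.2 (by omega)), if_pos (Nat.succ_pos i), Nat.add_sub_cancel]

/-- The signed weights are linear in j before the last index, so second differences kill them; the
boundary signs make row k - 2 vanish too, and only the last row survives. -/
theorem rowForm_weight {k i : ℕ} (hi : i < k) :
    rowForm k (fun j => if j + 1 = k then -1 else (j : ℚ) + 1) i = if i + 1 = k then (k : ℚ) else 0 := by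
  rw [rowForm]
  rcases i with _ | i
  · rcases eq_or_ne k 1 with rfl | h1
    · norm_num
    · rcases eq_or_ne k 2 with rfl | h2
      · norm_num
      · simp [Ne.symm h1, Ne.symm h2, show 1 < k by omega]
        norm_num
  · simp only [Nat.succ_pos, if_true, Nat.add_sub_cancel, Nat.cast_add, Nat.cast_one]
    rw [if_neg (by omega : ¬ i + 1 = k)]
    by_cases h1 : i + 1 + 1 = k
    · subst h1
      norm_num
      ring
    · rw [if_neg h1, if_pos (by omega : i + 1 + 1 < k), if_neg h1, if_neg h1, if_neg h1]
      by_cases h2 : i + 1 + 1 + 1 = k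
      · rw [if_pos h2, if_pos h2, if_pos h2]
        ring
      · rw [if_neg h2, if_neg h2, if_neg h2]
        ring

/-- min(j, b) + 1 is the Green function of the discrete second difference. Cutting it off at the
last index leaves the error b + 1 in the last row. -/
theorem rowForm_min {k i b : ℕ} (hi : i < k) (hb : b < k) :
    rowForm k (fun j => if j + 1 < k ∧ b + 1 < k then ((min j b + 1 : ℕ) : ℚ) else 0) i =
      if b + 1 < k then (if i + 1 = k then (b : ℚ) + 1 else if i = b then 1 else 0) else 0 := by
  by_cases hb' : b + 1 < k
  swap
  · simp [rowForm, hb']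
  simp only [hb', and_true, if_true]
  rw [rowForm]
  rcases lt_trichotomy i b with h | rfl | h
  · obtain ⟨e, rfl⟩ : ∃ e, b = i + 1 + e := Nat.exists_eq_add_of_le h
    simp only [show ¬ i + 1 = k by omega, show ¬ i + 2 = k by omega, show i + 1 < k by omega,
      show i + 1 + 1 < k by omega, show ¬ i = i + 1 + e by omega, if_true, if_false,
      min_eq_left (show i ≤ i + 1 + e by omega), min_eq_left (show i + 1 ≤ i + 1 + e by omega),
      min_eq_left (show i - 1 ≤ i + 1 + e by omega)]
    rcases i with _ | i
    · norm_num
    · rw [if_pos (by omega : 0 < i + 1), if_pos (by omega : i + 1 - 1 + 1 < k)]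
      push_cast [Nat.add_sub_cancel]
      ring
  · rw [if_neg (by omega : ¬ i + 1 = k), if_neg (by omega : ¬ i + 1 = k), if_pos hb', if_pos hb', if_pos rfl,
      min_self, min_eq_right (by omega), min_eq_left (by omega)]
    rcases i with _ | i
    · by_cases h2 : 0 + 2 = k
      · subst h2; norm_num
      · rw [if_neg h2, if_neg h2, if_pos (by omega)]; norm_num
    · rw [if_pos (by omega : 0 < i + 1), if_pos (by omega : i + 1 - 1 + 1 < k), if_neg (by omega : ¬ i + 1 + 1 = k)]
      by_cases h2 : i + 1 + 2 = k
      · rw [if_pos h2, if_pos h2, if_neg (by omega)]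
        push_cast [Nat.add_sub_cancel]; ring
      · rw [if_neg h2, if_neg h2, if_pos (by omega)]
        push_cast [Nat.add_sub_cancel]; ring
  · obtain ⟨e, rfl⟩ : ∃ e, i = b + 1 + e := Nat.exists_eq_add_of_le h
    rw [min_eq_right (by omega : b ≤ b + 1 + e), min_eq_right (by omega : b ≤ b + 1 + e + 1),
      min_eq_right (by omega : b ≤ b + 1 + e - 1),
      if_neg (by omega : ¬ b + 1 + e = b), if_pos (by omega : 0 < b + 1 + e),
      if_pos (by omega : b + 1 + e - 1 + 1 < k)]
    by_cases h1 : b + 1 + e + 1 = k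
    · simp [h1]
    · have h3 : b + 1 + e + 1 < k := by omega
      by_cases h2 : b + 1 + e + 2 = k
      · simp only [h1, h2, h3, lt_self_iff_false, if_true, if_false]
        ring
      · simp only [h1, h2, h3, show b + 1 + e + 1 + 1 < k by omega, if_true, if_false]
        ring

/-- The rank-one term W Wᵗ / k repairs the last row: Θ⁻¹ W is k times the last basis vector, so
subtracting it cancels the error b + 1, and in the last column W_b = -1 supplies the missing 1. -/
theorem thetaInv_mul (k : ℕ) :
    thetaInv (k : ℚ) * Matrix.of (fun i j : Fin (size (k : ℚ)) => thetaEntry k i j) = 1 := by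
  have hsz := size_natCast k
  ext i l
  have hi : i.val < k := i.isLt.trans_eq hsz
  have hl : l.val < k := l.isLt.trans_eq hsz
  rw [Matrix.mul_apply, Matrix.one_apply]
  simp only [thetaInv, Matrix.of_apply, Fin.ext_iff]
  rw [← Finset.sum_range (fun j => c (k : ℚ) (i.val + 1) (j + 1) * thetaEntry k j l)]
  generalize i.val = a at *
  generalize l.val = b at *
  rw [hsz]
  set W : ℕ → ℚ := fun j => if j + 1 = k then -1 else (j : ℚ) + 1 with hW
  set T : ℕ → ℚ := fun j => if j + 1 < k ∧ b + 1 < k then ((min j b + 1 : ℕ) : ℚ) else 0 with hT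
  have hn : ∀ j < k, sgn k j * (n (k : ℚ) (j + 1) : ℚ) = W j := by
    intro j hj
    rw [n_natCast, sgn, hW]
    by_cases h : j + 1 = k
    · simp [h]
    · simp [h, show j + 1 < k by omega]
  have hentry : ∀ j ∈ range k, c (k : ℚ) (a + 1) (j + 1) * thetaEntry k j b =
      c (k : ℚ) (a + 1) (j + 1) * T j - c (k : ℚ) (a + 1) (j + 1) * W j * (W b / k) := by
    intro j hj
    have hTs : sgn k j * sgn k b * T j = T j := by
      simp only [hT, sgn]
      by_cases h : j + 1 < k ∧ b + 1 < k
      · simp [h.1.ne, h.2.ne]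
      · simp [h]
    rw [thetaEntry, ← hn j (mem_range.1 hj), ← hn b hl]
    linear_combination c (k : ℚ) (a + 1) (j + 1) * hTs
  rw [sum_congr rfl hentry, sum_sub_distrib, ← sum_mul, sum_c_mul hi, sum_c_mul hi, rowForm_min hi hl,
    rowForm_weight hi]
  by_cases ha : a + 1 = k
  · rw [if_pos ha, if_pos ha, mul_div_cancel₀ _ (Nat.cast_ne_zero.2 (by omega)), hW]
    by_cases hb : b + 1 = k
    · simp [hb, show a = b by omega]
    · simp [hb, show b + 1 < k by omega, show a ≠ b by omega]
  · rw [if_neg ha, if_neg ha]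
    by_cases hb : b + 1 = k
    · simp [hb, show a ≠ b by omega]
    · simp [show b + 1 < k by omega]

theorem tilde_form (k : ℕ) (lam : Fin (size (k : ℚ)) → ℕ) (l : ℕ)
    (hl : ∑ j : Fin (size (k : ℚ)), n (k : ℚ) (j.val + 1) * lam j = l) :
    1 / 2 * (tilde (k : ℚ) lam ⬝ᵥ Matrix.mulVec (B (k : ℚ)) (tilde (k : ℚ) lam)) =
      ((∑ i : Fin (size (k : ℚ)), ∑ j : Fin (size (k : ℚ)),
        if i.val + 1 < k ∧ j.val + 1 < k then (min i.val j.val + 1) * (lam i * lam j) else 0 : ℕ) : ℚ)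
        - (l : ℚ) ^ 2 / k := by
  have hB : B (k : ℚ) = (2 : ℚ) • Matrix.of (fun i j : Fin (size (k : ℚ)) => thetaEntry k i j) := by
    rw [B, Matrix.inv_eq_right_inv (thetaInv_mul k)]
  have hs : ∀ j, (-1 : ℚ) ^ r (k : ℚ) (j + 1) = if k ≤ j + 1 then -1 else 1 := by
    intro j
    rw [r_natCast]
    split_ifs <;> simp
  have hsz := size_natCast k
  rw [hB, Matrix.smul_mulVec, dotProduct_smul, smul_eq_mul, ← mul_assoc]
  norm_num only
  rw [one_mul, ← hl]
  push_cast
  rw [sq, sum_mul_sum, sum_div, ← sum_sub_distrib]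
  simp only [dotProduct, Matrix.mulVec, mul_sum, sum_div, ← sum_sub_distrib, Matrix.of_apply]
  refine sum_congr rfl fun i _ => sum_congr rfl fun j _ => ?_
  have hi : i.val < k := i.isLt.trans_eq hsz
  have hj : j.val < k := j.isLt.trans_eq hsz
  have key : ∀ a, a < k → (if k ≤ a + 1 then (-1 : ℚ) else 1) * sgn k a = 1 := by
    intro a ha
    rw [sgn]
    split_ifs <;> first | omega | norm_num
  have e : ∀ (s t s' t' x y u v : ℚ), s * s' = 1 → t * t' = 1 →
      s * x * (s' * t' * (u - v) * (t * y)) = u * (x * y) - v * (x * y) := by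
    intro s t s' t' x y u v h1 h2
    linear_combination (x * y * (u - v) * t * t') * h1 + (x * y * (u - v)) * h2
  simp only [tilde, hs, thetaEntry]
  rw [e _ _ _ _ _ _ _ _ (key _ hi) (key _ hj)]
  congr 1
  · split_ifs <;> push_cast <;> ring
  · ring

/-! ### Factoring the summand and summing over λ -/

/-- Multiply 1 - q^{-j} = -q^{-j}(1 - q^j) over 1 ≤ j ≤ k; the exponents add up to k(k + 1)/2. -/
theorem qPoch_inv {q : ℂ} (hq0 : q ≠ 0) (k : ℕ) :
    qPoch q⁻¹ q⁻¹ k * ((-1) ^ k * q ^ (k.choose 2 + k)) = qPoch q q k := by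
  induction k with
  | zero => simp [qPoch_zero]
  | succ k ih =>
    rw [qPoch_succ, qPoch_succ, ← ih, Nat.choose_succ_succ' k 1, Nat.choose_one_right, inv_pow]
    have : q ^ k ≠ 0 := pow_ne_zero _ hq0
    field_simp
    ring

theorem qpow_natCast (w : ℂ) (k : ℕ) : qpow w (k : ℚ) = Complex.exp w ^ k := by
  rw [qpow, ← Complex.exp_nat_mul]
  simp

theorem qpow_add (w : ℂ) (a b : ℚ) : qpow w (a + b) = qpow w a * qpow w b := by
  rw [qpow, qpow, qpow, ← Complex.exp_add]
  push_cast
  ring_nf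

theorem qpow_one (w : ℂ) : qpow w 1 = Complex.exp w := by simp [qpow]

theorem qpow_neg_one (w : ℂ) : qpow w (-1) = (Complex.exp w)⁻¹ := by
  simp [qpow, Complex.exp_neg]

/-- The summand of `∑ q^{l²/p₀} V_l` for integral `p₀ = d + 1`. -/
theorem term_eq (d : ℕ) (w : ℂ) (l : ℕ) (lam : Fin (size ((d + 1 : ℕ) : ℚ)) → ℕ)
    (hl : ∑ j, n ((d + 1 : ℕ) : ℚ) (j.val + 1) * lam j = l) :
    qpow w ((l : ℚ) ^ 2 / (d + 1 : ℕ)) *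
      (qpow w (1 / 2 * (tilde ((d + 1 : ℕ) : ℚ) lam ⬝ᵥ
          Matrix.mulVec (B ((d + 1 : ℕ) : ℚ)) (tilde ((d + 1 : ℕ) : ℚ) lam))) /
      ∏ j : Fin (size ((d + 1 : ℕ) : ℚ)), qPoch (qpow w ((-1) ^ r ((d + 1 : ℕ) : ℚ) (j.val + 1)))
        (qpow w ((-1) ^ r ((d + 1 : ℕ) : ℚ) (j.val + 1))) (lam j)) =
      gordonTerm (Complex.exp w)
        (fun i : Fin d => lam (Fin.cast (size_natCast (d + 1)).symm i.castSucc)) *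
      ((-1) ^ lam (Fin.cast (size_natCast (d + 1)).symm (Fin.last d)) *
        Complex.exp w ^ ((lam (Fin.cast (size_natCast (d + 1)).symm (Fin.last d))).choose 2 +
          lam (Fin.cast (size_natCast (d + 1)).symm (Fin.last d))) /
        qPoch (Complex.exp w) (Complex.exp w)
          (lam (Fin.cast (size_natCast (d + 1)).symm (Fin.last d)))) := by
  have hsz := size_natCast (d + 1)
  have hcast : ∀ (R : Type) [AddCommMonoid R] (f : Fin (size ((d + 1 : ℕ) : ℚ)) → R),
      ∑ i, f i = ∑ i : Fin (d + 1), f (Fin.cast hsz.symm i) :=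
    fun R _ f => ((finCongr hsz.symm).sum_comp f).symm
  have hcastp : ∀ (f : Fin (size ((d + 1 : ℕ) : ℚ)) → ℂ),
      ∏ i, f i = ∏ i : Fin (d + 1), f (Fin.cast hsz.symm i) :=
    fun f => ((finCongr hsz.symm).prod_comp f).symm
  -- The two fractional exponents l²/k cancel here, and with them the dependence on the logarithm
  -- `w`.
  rw [tilde_form (d + 1) lam l hl, ← mul_div_assoc, ← qpow_add, add_sub_cancel,
    qpow_natCast, hcastp, Fin.prod_univ_castSucc]
  simp only [hcast, Fin.sum_univ_castSucc]
  simp only [Fin.val_cast, Fin.val_castSucc, Fin.val_last, lt_self_iff_false, false_and, and_false,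
    if_false, add_zero, sum_const_zero, r_natCast, le_refl, if_true, pow_one]
  simp only [add_lt_add_iff_right, Fin.is_lt, and_true, if_true, add_le_add_iff_right,
    not_le.2 (Fin.is_lt _), if_false, pow_zero, qpow_one, qpow_neg_one]
  rw [gordonTerm, div_mul_div_comm, ← qPoch_inv (Complex.exp_ne_zero w)]
  have h1 : ∀ k : ℕ, (-1 : ℂ) ^ k * Complex.exp w ^ (k.choose 2 + k) ≠ 0 := fun k =>
    mul_ne_zero (pow_ne_zero _ (by norm_num)) (pow_ne_zero _ (Complex.exp_ne_zero w))
  rw [← mul_assoc (∏ _, _), mul_div_mul_right _ _ (h1 _)]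

theorem hasSum_V (d : ℕ) {w : ℂ} (hq : ‖Complex.exp w‖ < 1) :
    HasSum (fun l : ℕ => qpow w ((l : ℚ) ^ 2 / (d + 1 : ℕ)) * V ((d + 1 : ℕ) : ℚ) l w)
      (∑' s : ℕ, Complex.exp w ^ ((d + 1) * s ^ 2) * thetaCoeff (Complex.exp w) 1 (Complex.exp w) s) := by
  set q := Complex.exp w
  have hq0 : q ≠ 0 := Complex.exp_ne_zero w
  have hsz := size_natCast (d + 1)
  set E : ℕ → ℂ := fun m => (-1) ^ m * q ^ (m.choose 2 + m) / qPoch q q m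
  obtain ⟨hE, hE'⟩ := hasSum_euler hq
  have hG := summable_gordonTerm hq d
  -- Splits off the last variable, which separates the family into a Gordon term times an Euler
  -- term.
  let e : (Fin (size ((d + 1 : ℕ) : ℚ)) → ℕ) ≃ (Fin d → ℕ) × ℕ :=
    { toFun := fun lam => (fun i => lam (Fin.cast hsz.symm i.castSucc), lam (Fin.cast hsz.symm (Fin.last d)))
      invFun := fun x j => (Fin.snoc x.1 x.2 : Fin (d + 1) → ℕ) (Fin.cast hsz j)
      left_inv := by
        intro lam
        refine funext fun j => ?_
        obtain ⟨i, rfl⟩ : ∃ i, j = Fin.cast hsz.symm i := ⟨Fin.cast hsz j, by simp⟩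
        refine Fin.lastCases ?_ (fun i => ?_) i <;> simp
      right_inv := by
        rintro ⟨x, a⟩
        simp }
  have hS : Summable fun x : (Fin d → ℕ) × ℕ => gordonTerm q x.1 * E x.2 :=
    summable_mul_of_summable_norm hG hE
  have hT : ∑' x : (Fin d → ℕ) × ℕ, gordonTerm q x.1 * E x.2 =
      ∑' s : ℕ, q ^ ((d + 1) * s ^ 2) * thetaCoeff q 1 q s := by
    rw [← tsum_mul_tsum_of_summable_norm hG hE, hE', tsum_gordonTerm hq hq0]
  have h := hasSum_sum_fiber (e.summable_iff.2 hS)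
    (fun lam => ∑ j, n ((d + 1 : ℕ) : ℚ) (j.val + 1) * lam j) (states ((d + 1 : ℕ) : ℚ))
    (fun l lam => mem_states _ (by simp) l lam)
  have he := e.tsum_eq (fun x : (Fin d → ℕ) × ℕ => gordonTerm q x.1 * E x.2)
  simp only [Function.comp_def] at h
  rw [he, hT] at h
  convert h using 2 with l
  rw [V, mul_sum]
  refine sum_congr rfl fun lam hlam => ?_
  rw [mem_states _ (by simp)] at hlam
  exact term_eq d w l lam hlam

/-! ### Products over residue classes -/

theorem summable_norm_indicator {q : ℂ} (hq : ‖q‖ < 1) (X : Set ℕ) :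
    Summable fun n => ‖X.indicator (fun n => -q ^ n) n‖ := by
  refine Summable.of_nonneg_of_le (fun _ => norm_nonneg _) (fun n => ?_)
    (summable_geometric_of_lt_one (norm_nonneg q) hq)
  rw [← norm_pow, ← norm_neg (q ^ n)]
  exact norm_indicator_le_norm_self _ _

theorem mulIndicator_one_sub_pow (q : ℂ) (X : Set ℕ) :
    (fun n => 1 + X.indicator (fun n => -q ^ n) n) = X.mulIndicator fun n => 1 - q ^ n := by
  classical
  funext n
  rw [Set.indicator_apply, Set.mulIndicator_apply]
  split_ifs <;> ring

theorem multipliable_mulIndicator {q : ℂ} (hq : ‖q‖ < 1) (X : Set ℕ) :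
    Multipliable (X.mulIndicator fun n => 1 - q ^ n) := by
  rw [← mulIndicator_one_sub_pow]
  exact multipliable_one_add_of_summable (summable_norm_indicator hq X)

/-- Puts all the products on the common index set ℕ, so that they can be compared factor by factor.
-/
theorem qPochInf_pow_eq_tprod (q : ℂ) {N : ℕ} (hN : 0 < N) (c : ℕ) :
    qPochInf (q ^ c) (q ^ N) =
      ∏' n, (Set.range fun n => N * n + c).mulIndicator (fun n => 1 - q ^ n) n := by
  have hg : Function.Injective fun n => N * n + c := fun a b h => by
    have : N * a = N * b := by simpa using h
    exact Nat.eq_of_mul_eq_mul_left hN this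
  rw [← hg.tprod_eq (Set.mulSupport_mulIndicator_subset), qPochInf]
  refine tprod_congr fun n => ?_
  rw [Set.mulIndicator_of_mem (Set.mem_range_self n), pow_add, pow_mul, mul_comm]

theorem mem_range_mul_add {N c : ℕ} (hc : 1 ≤ c) (hcN : c ≤ N) (n : ℕ) :
    (n ∈ Set.range fun n => N * n + c) ↔ 1 ≤ n ∧ n ≡ c [MOD N] := by
  constructor
  · rintro ⟨a, rfl⟩
    exact ⟨by simp only; omega, by simp [Nat.ModEq]⟩
  · rintro ⟨h1, h2⟩
    have hle : c ≤ n := by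
      by_contra hlt
      have := (Nat.modEq_iff_dvd' (by omega : n ≤ c)).1 h2
      have := Nat.le_of_dvd (by omega) this
      omega
    obtain ⟨a, ha⟩ := (Nat.modEq_iff_dvd' hle).1 h2.symm
    exact ⟨a, by simp only; omega⟩

/-- Splitting Euler's product by the residues modulo `2 k + 1`. -/
theorem qPochInf_self_eq_mul {q : ℂ} (hq : ‖q‖ < 1) {k : ℕ} (hk : 1 ≤ k) :
    qPochInf q q = (∏' n, {n : ℕ | 1 ≤ n ∧ ¬ n ≡ 0 [MOD 2 * k + 1] ∧ ¬ n ≡ k [MOD 2 * k + 1] ∧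
        ¬ n ≡ k + 1 [MOD 2 * k + 1]}.mulIndicator (fun n => 1 - q ^ n) n) *
      (qPochInf (q ^ (2 * k + 1)) (q ^ (2 * k + 1)) * qPochInf (q ^ k) (q ^ (2 * k + 1)) *
        qPochInf (q ^ (k + 1)) (q ^ (2 * k + 1))) := by
  classical
  have hm := multipliable_mulIndicator hq
  have h1 := qPochInf_pow_eq_tprod q one_pos 1
  rw [pow_one] at h1
  rw [h1, qPochInf_pow_eq_tprod q (by omega), qPochInf_pow_eq_tprod q (by omega),
    qPochInf_pow_eq_tprod q (by omega), ← (hm _).tprod_mul (hm _),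
    ← ((hm _).mul (hm _)).tprod_mul (hm _), ← (hm _).tprod_mul (((hm _).mul (hm _)).mul (hm _))]
  refine tprod_congr fun n => ?_
  simp only [Set.mulIndicator_apply, mem_range_mul_add le_rfl le_rfl,
    mem_range_mul_add (by omega : 1 ≤ 2 * k + 1) le_rfl,
    mem_range_mul_add hk (by omega : k ≤ 2 * k + 1),
    mem_range_mul_add (by omega : 1 ≤ k + 1) (by omega : k + 1 ≤ 2 * k + 1), Set.mem_ofPred_eq,
    Nat.ModEq, Nat.mod_one, and_true, Nat.mod_self, Nat.zero_mod,
    Nat.mod_eq_of_lt (by omega : k < 2 * k + 1), Nat.mod_eq_of_lt (by omega : k + 1 < 2 * k + 1)]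
  -- As k ≥ 1, the residues 0, k, k + 1 are distinct modulo 2k + 1, so each n ≥ 1 lies in exactly
  -- one of the four sets; at n = 0 every factor is 1.
  by_cases h : 1 ≤ n
  · simp only [h, true_and, if_true]
    by_cases h0 : n % (2 * k + 1) = 0
    · simp only [h0, show ¬ 0 = k by omega, show ¬ 0 = k + 1 by omega, not_true, false_and,
        if_true, if_false, mul_one, one_mul]
    · by_cases h1 : n % (2 * k + 1) = k
      · simp only [h1, show ¬ k = 0 by omega, show ¬ k = k + 1 by omega, not_true, false_and,
          and_false, if_true, if_false, mul_one, one_mul]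
      · by_cases h2 : n % (2 * k + 1) = k + 1
        · simp only [h2, show ¬ k + 1 = 0 by omega, show ¬ k + 1 = k by omega, not_true, and_false,
            if_true, if_false, one_mul]
        · simp only [h0, h1, h2, not_false_eq_true, and_true, if_true, if_false, mul_one]
  · simp [h]

/-- Since s² = 2 (s choose 2) + s, the Gaussian weight is absorbed by passing to base q^{2k+1} and
multiplying z and z' by q^k. -/
theorem pow_mul_thetaCoeff (q : ℂ) (k s : ℕ) :
    q ^ (k * s ^ 2) * thetaCoeff q 1 q s = thetaCoeff (q ^ (2 * k + 1)) (q ^ k) (q ^ (k + 1)) s := by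
  rcases Nat.eq_zero_or_pos s with rfl | hs
  · simp [thetaCoeff]
  · rw [thetaCoeff, thetaCoeff, if_neg hs.ne', if_neg hs.ne', ← two_mul_choose_two s]
    ring

theorem thetaCoeff_of_pos (q : ℂ) (k : ℕ) {s : ℕ} (hs : s ≠ 0) :
    (-1) ^ s * q ^ (s ^ 2 * k + s * (s - 1) / 2) * (1 + q ^ s) =
      thetaCoeff (q ^ (2 * k + 1)) (q ^ k) (q ^ (k + 1)) s := by
  rw [← pow_mul_thetaCoeff, thetaCoeff, if_neg hs, ← Nat.choose_two_right]
  ring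

theorem triple_factor (q : ℂ) (k n : ℕ) :
    (1 - q ^ ((2 * k + 1) * (n + 1))) * (1 - q ^ ((2 * k + 1) * (n + 1) - k - 1)) *
        (1 - q ^ ((2 * k + 1) * (n + 1) - k)) =
      (1 - q ^ (2 * k + 1) * (q ^ (2 * k + 1)) ^ n) * (1 - q ^ k * (q ^ (2 * k + 1)) ^ n) *
        (1 - q ^ (k + 1) * (q ^ (2 * k + 1)) ^ n) := by
  have e : (2 * k + 1) * (n + 1) = (2 * k + 1) * n + (2 * k + 1) := by ring
  rw [show (2 * k + 1) * (n + 1) - k - 1 = k + (2 * k + 1) * n by omega,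
    show (2 * k + 1) * (n + 1) - k = k + 1 + (2 * k + 1) * n by omega]
  simp only [← pow_mul, ← pow_add]
  rw [e, add_comm (2 * k + 1)]

end XXZ

/-! ### The three identities -/

theorem mainTheorem4 (p0 : ℕ) (hp0 : 1 ≤ p0) (q w : ℂ) (hw : Complex.exp w = q) (hq : ‖q‖ < 1) :
    -- the first identity, with the convergence of both series
    (Summable (fun l : ℕ => XXZ.qpow w ((l : ℚ) ^ 2 / p0) * XXZ.V p0 l w) ∧
      Summable (fun k : ℕ+ =>
        (-1 : ℂ) ^ (k : ℕ) * q ^ ((k : ℕ) ^ 2 * p0 + (k : ℕ) * ((k : ℕ) - 1) / 2) *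
          (1 + q ^ (k : ℕ))) ∧
      ∑' l : ℕ, XXZ.qpow w ((l : ℚ) ^ 2 / p0) * XXZ.V p0 l w =
        1 + ∑' k : ℕ+,
          (-1 : ℂ) ^ (k : ℕ) * q ^ ((k : ℕ) ^ 2 * p0 + (k : ℕ) * ((k : ℕ) - 1) / 2) *
            (1 + q ^ (k : ℕ))) ∧
    -- the product form, with the convergence of the product
    (Multipliable (fun n : ℕ+ =>
        (1 - q ^ ((2 * p0 + 1) * (n : ℕ))) * (1 - q ^ ((2 * p0 + 1) * (n : ℕ) - p0 - 1)) *
          (1 - q ^ ((2 * p0 + 1) * (n : ℕ) - p0))) ∧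
      ∑' l : ℕ, XXZ.qpow w ((l : ℚ) ^ 2 / p0) * XXZ.V p0 l w =
        ∏' n : ℕ+,
          (1 - q ^ ((2 * p0 + 1) * (n : ℕ))) * (1 - q ^ ((2 * p0 + 1) * (n : ℕ) - p0 - 1)) *
            (1 - q ^ ((2 * p0 + 1) * (n : ℕ) - p0))) ∧
    -- the Gordon-Andrews product, with the convergence of the products
    (Multipliable (fun k : ℕ => 1 - q * q ^ k) ∧ XXZ.qPochInf q q ≠ 0 ∧
      Multipliable (fun n : {n : ℕ // 1 ≤ n ∧ ¬ n ≡ 0 [MOD 2 * p0 + 1] ∧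
        ¬ n ≡ p0 [MOD 2 * p0 + 1] ∧ ¬ n ≡ p0 + 1 [MOD 2 * p0 + 1]} => (1 - q ^ (n : ℕ))⁻¹) ∧
      1 / XXZ.qPochInf q q * ∑' l : ℕ, XXZ.qpow w ((l : ℚ) ^ 2 / p0) * XXZ.V p0 l w =
        ∏' n : {n : ℕ // 1 ≤ n ∧ ¬ n ≡ 0 [MOD 2 * p0 + 1] ∧
          ¬ n ≡ p0 [MOD 2 * p0 + 1] ∧ ¬ n ≡ p0 + 1 [MOD 2 * p0 + 1]}, (1 - q ^ (n : ℕ))⁻¹) := by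
  have hq0 : q ≠ 0 := hw ▸ Complex.exp_ne_zero w
  have hpow : ∀ {j : ℕ}, j ≠ 0 → ‖q ^ j‖ < 1 := fun hj => by
    rw [norm_pow]
    exact pow_lt_one₀ (norm_nonneg q) hq hj
  have hQ : ‖q ^ (2 * p0 + 1)‖ < 1 := hpow (by omega)
  have hz : ‖q ^ p0‖ < 1 := hpow (by omega)
  have hz' : ‖q ^ (p0 + 1)‖ < 1 := hpow (by omega)
  have hsum : HasSum (fun l : ℕ => XXZ.qpow w ((l : ℚ) ^ 2 / p0) * XXZ.V p0 l w)
      (∑' s, XXZ.thetaCoeff (q ^ (2 * p0 + 1)) (q ^ p0) (q ^ (p0 + 1)) s) := by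
    obtain ⟨d, rfl⟩ := Nat.exists_eq_add_of_le' hp0
    subst hw
    simpa only [XXZ.pow_mul_thetaCoeff] using XXZ.hasSum_V d hq
  have htheta := (XXZ.summable_thetaCoeff hQ hz.le hz'.le).of_norm
  have htriple := XXZ.tsum_thetaCoeff hQ (pow_ne_zero _ hq0)
    (show q ^ p0 * q ^ (p0 + 1) = q ^ (2 * p0 + 1) by ring) hz.le hz'.le
  have hmult := ((XXZ.multipliable_qPoch (q ^ (2 * p0 + 1)) hQ).mul
    (XXZ.multipliable_qPoch (q ^ p0) hQ)).mul (XXZ.multipliable_qPoch (q ^ (p0 + 1)) hQ)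
  have hne := XXZ.qPochInf_ne_zero hq hq
  refine ⟨⟨hsum.summable, ?_, ?_⟩, ⟨?_, ?_⟩, XXZ.multipliable_qPoch q hq, hne, ?_⟩
  · simp only [XXZ.thetaCoeff_of_pos q p0 (PNat.ne_zero _)]
    exact htheta.comp_injective PNat.coe_injective
  · simp only [XXZ.thetaCoeff_of_pos q p0 (PNat.ne_zero _)]
    rw [hsum.tsum_eq, htheta.tsum_eq_zero_add, tsum_pnat_eq_tsum_succ
      (f := XXZ.thetaCoeff (q ^ (2 * p0 + 1)) (q ^ p0) (q ^ (p0 + 1)))]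
    rfl
  · refine (multipliable_pnat_iff_multipliable_succ (f := fun n : ℕ =>
      (1 - q ^ ((2 * p0 + 1) * n)) * (1 - q ^ ((2 * p0 + 1) * n - p0 - 1)) *
          (1 - q ^ ((2 * p0 + 1) * n - p0)))).2 ?_
    simpa only [XXZ.triple_factor] using hmult
  · rw [tprod_pnat_eq_tprod_succ (f := fun n : ℕ =>
      (1 - q ^ ((2 * p0 + 1) * n)) * (1 - q ^ ((2 * p0 + 1) * n - p0 - 1)) *
          (1 - q ^ ((2 * p0 + 1) * n - p0)))]
    simp only [XXZ.triple_factor]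
    rw [hsum.tsum_eq, htriple, Multipliable.tprod_mul ((XXZ.multipliable_qPoch _ hQ).mul
      (XXZ.multipliable_qPoch _ hQ)) (XXZ.multipliable_qPoch _ hQ),
      Multipliable.tprod_mul (XXZ.multipliable_qPoch _ hQ) (XXZ.multipliable_qPoch _ hQ)]
    rfl
  · set X : Set ℕ := {n : ℕ | 1 ≤ n ∧ ¬ n ≡ 0 [MOD 2 * p0 + 1] ∧ ¬ n ≡ p0 [MOD 2 * p0 + 1] ∧
      ¬ n ≡ p0 + 1 [MOD 2 * p0 + 1]} with hX
    have hsplit := XXZ.qPochInf_self_eq_mul hq hp0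
    rw [← hX, ← htriple, ← hsum.tsum_eq, ← tprod_subtype] at hsplit
    have hXm : Multipliable fun n : X => 1 - q ^ (n : ℕ) :=
      multipliable_subtype_iff_mulIndicator.2 (XXZ.multipliable_mulIndicator hq X)
    -- It is a factor of (q; q)_∞, which is nonzero.
    have hX0 : ∏' n : X, (1 - q ^ (n : ℕ)) ≠ 0 := left_ne_zero_of_mul (hsplit ▸ hne)
    refine ⟨hXm.inv₀ hX0, (?_ : _ = ∏' n : X, (1 - q ^ (n : ℕ))⁻¹)⟩
    rw [Multipliable.tprod_inv₀ hXm hX0, hsplit, one_div, mul_inv, mul_assoc,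
      inv_mul_cancel₀ (right_ne_zero_of_mul (hsplit ▸ hne)), mul_one]
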